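/- Let $X$ be an Archimedean Riesz space (a real vector lattice in which $0\le nx\le y$ for all integers $n\ge 1$ implies $x=0$) with a unit $e$, i.e. $e\neq 0$ and for each $x\in X$ there is $\lambda\ge 0$ with $-\lambda e\le x\le \lambda e$. Let $X^\star$ be the dual of $X$ for the norm $\|x\|=\inf\{\lambda\ge 0: |x|\le\lambda e\}$, endowed with the weak$^\star$ topology, and let $X^\star_+$ be its set of positive functionals. Let $N\subsetneq X$ be an order ideal (a vector subspace such that $|x|\le|y|$ and $y\in N$ imply $x\in N$) which is uniformly closed: $x\in N$ whenever there are $x_n\in N$, a vector $y>0$ and positive reals $\varepsilon_n$ decreasing to $0$ with $|x_n-x|\le\varepsilon_n y$ for all $n$. Let $\mathcal E_N$ be the set of extreme points of $\{\xi\in X^\star_+:\langle e,\xi\rangle=1,\ \xi|_N=0\}$, with the relative weak$^\star$ topology and its Borel $\sigma$-algebra $\mathscr B(\mathcal E_N)$. Let $V:X\to\mathbf R$ satisfy 1. (normalized) $V(\lambda e)=\lambda$ for all $\lambda\in\mathbf R$; 2. (monotone) $V(x)\le V(y)$ whenever $x\le y$; 3. (unit-additive) $V(x+\lambda e)=V(x)+V(\lambda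 e)$ for all $x\in X$ and $\lambda\ge 0$; 4. (unit-modular) $V(x\vee\lambda e)+V(x\wedge\lambda e)=V(x)+V(\lambda e)$ for all $x\in X$ and $\lambda\in\mathbf R$; 5. ($N$-invariant) $V(x)=V(y)$ whenever $x-y\in N$. Then there exists a normalized capacity $\nu:\mathscr B(\mathcal E_N)\to\mathbf R$ (that is, $\nu(A)\le\nu(B)$ whenever $A\subseteq B$, $\nu(\emptyset)=0$ and $\nu(\mathcal E_N)=1$) such that for every $x\in X$ the function $\xi\mapsto\langle x,\xi\rangle$ is bounded and Borel measurable on $\mathcal E_N$ and $$V(x)=\int_{\mathcal E_N}\langle x,\xi\rangle\,\mathrm d\nu(\xi),$$ where the right-hand side is the Choquet integral $$\int_{\mathcal E_N} f\,\mathrm d\nu:=\int_0^\infty\nu(f\ge t)\,\mathrm dt+\int_{-\infty}^0\bigl[\nu(f\ge t)-\nu(\mathcal E_N)\bigr]\,\mathrm dt .$$ -/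

import Mathlib

/-! Archimedean Riesz spaces with unit. A Riesz space is a real vector space with a lattice order
compatible with addition (`IsOrderedAddMonoid`) and with scalar multiplication
(`IsOrderedModule ℝ`). -/

namespace RieszChoquet

section Riesz

variable {X : Type*} [AddCommGroup X] [Lattice X]

/-- A Riesz space is Archimedean if `0 ≤ n x ≤ y` for all positive integers `n` forces `x = 0`. -/
def IsArchimedean (X : Type*) [AddCommGroup X] [Lattice X] : Prop :=
  ∀ x y : X, (∀ n : ℕ, 1 ≤ n → 0 ≤ n • x ∧ n • x ≤ y) → x = 0

variable [Module ℝ X]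

/-- `e` is a (strong order) unit. -/
def IsUnitVector (e : X) : Prop :=
  e ≠ 0 ∧ ∀ x : X, ∃ c : ℝ, 0 ≤ c ∧ -(c • e) ≤ x ∧ x ≤ c • e

/-- A vector subspace is an order ideal if it is solid. -/
def IsOrderIdeal (N : Submodule ℝ X) : Prop :=
  ∀ x y : X, y ∈ N → |x| ≤ |y| → x ∈ N

/-- Uniformly closed: closed under relatively uniform limits of sequences. -/
def IsUniformlyClosed (N : Submodule ℝ X) : Prop :=
  ∀ (x : X) (u : ℕ → X) (y : X) (ε : ℕ → ℝ),
    (∀ n, u n ∈ N) → 0 < y → (∀ n, 0 < ε n) → Antitone ε →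
    Filter.Tendsto ε Filter.atTop (nhds 0) →
    (∀ n, |u n - x| ≤ ε n • y) → x ∈ N

/-- The norm `‖x‖ = inf {c ≥ 0 : |x| ≤ c e}` induced by the unit `e`. -/
noncomputable def unitNorm (e x : X) : ℝ :=
  sInf {c : ℝ | 0 ≤ c ∧ |x| ≤ c • e}

/-- The norm dual: the linear functionals that are bounded for the norm induced by `e`. -/
def normDual (e : X) : Submodule ℝ (Module.Dual ℝ X) where
  carrier := {ξ | ∃ C : ℝ, ∀ x : X, |ξ x| ≤ C * unitNorm e x}
  zero_mem' := ⟨0, fun x => by simp⟩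
  add_mem' := by
    rintro ξ η ⟨C, hC⟩ ⟨D, hD⟩
    refine ⟨C + D, fun x => ?_⟩
    have h := abs_add_le (ξ x) (η x)
    have h1 := hC x
    have h2 := hD x
    rw [LinearMap.add_apply]
    linarith
  smul_mem' := by
    rintro a ξ ⟨C, hC⟩
    refine ⟨|a| * C, fun x => ?_⟩
    rw [LinearMap.smul_apply, smul_eq_mul, abs_mul, mul_assoc]
    exact mul_le_mul_of_nonneg_left (hC x) (abs_nonneg a)

/-- The norm dual with the weak* topology, the coarsest topology that makes all evaluations
`ξ ↦ ⟨x, ξ⟩` continuous. -/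
abbrev WeakStarDual (e : X) : Type _ := WeakBilin (normDual e).subtype

/-- The dual pairing `⟨x, ξ⟩`. -/
def pairing {e : X} (x : X) (ξ : WeakStarDual e) : ℝ := (normDual e).subtype ξ x

/-- `Δ`: the positive functionals in the norm dual that are `1` at `e`. -/
def positiveSphere (e : X) : Set (WeakStarDual e) :=
  {ξ | (∀ x : X, 0 ≤ x → 0 ≤ pairing x ξ) ∧ pairing e ξ = 1}

/-- `N^⊥`: the functionals in the norm dual that vanish on `N`. -/
def annihilator (e : X) (N : Submodule ℝ X) : Set (WeakStarDual e) :=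
  {ξ | ∀ x ∈ N, pairing x ξ = 0}

/-- `E_N`: the extreme points of `Δ ∩ N^⊥`, as a type. -/
def ExtremeFunctionals (e : X) (N : Submodule ℝ X) : Type _ :=
  {ξ : WeakStarDual e // ξ ∈ Set.extremePoints ℝ (positiveSphere e ∩ annihilator e N)}

/-- `E_N` carries the relative weak* topology. -/
instance (e : X) (N : Submodule ℝ X) : TopologicalSpace (ExtremeFunctionals e N) :=
  instTopologicalSpaceSubtype

/-- `E_N` carries its Borel σ-algebra. -/
instance (e : X) (N : Submodule ℝ X) : MeasurableSpace (ExtremeFunctionals e N) :=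
  borel _

instance (e : X) (N : Submodule ℝ X) : BorelSpace (ExtremeFunctionals e N) := ⟨rfl⟩

/-- The function `ξ ↦ ⟨x, ξ⟩` on `E_N`. -/
def evalAt (e : X) (N : Submodule ℝ X) (x : X) (ξ : ExtremeFunctionals e N) : ℝ :=
  pairing x ξ.1

theorem measurable_evalAt (e : X) (N : Submodule ℝ X) (x : X) : Measurable (evalAt e N x) := by
  have h : Continuous (evalAt e N x) :=
    (WeakBilin.eval_continuous (normDual e).subtype x).comp continuous_subtype_val
  exact h.measurable

end Riesz

section Capacity

variable {S : Type*} [MeasurableSpace S]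

/-- A normalized capacity: a monotone set function on the σ-algebra of `S` that is `0` at the
empty set and `1` at `S`. No additivity or continuity is required. -/
structure NormalizedCapacity (S : Type*) [MeasurableSpace S] where
  toFun : {A : Set S // MeasurableSet A} → ℝ
  mono' : ∀ A B : {A : Set S // MeasurableSet A}, A.1 ⊆ B.1 → toFun A ≤ toFun B
  empty' : toFun ⟨∅, MeasurableSet.empty⟩ = 0
  univ' : toFun ⟨Set.univ, MeasurableSet.univ⟩ = 1

/-- The capacity `ν(f ≥ t)` of an upper level set. -/
def NormalizedCapacity.level (ν : NormalizedCapacity S) (f : S → ℝ) (hf : Measurable f)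
    (t : ℝ) : ℝ :=
  ν.toFun ⟨{s | t ≤ f s}, measurableSet_le measurable_const hf⟩

/-- The Choquet integral of a bounded measurable function. For bounded `f` both integrands are
monotone in `t` and vanish outside a bounded interval, so they are integrable and the integrals
agree with the improper Riemann integrals. -/
noncomputable def NormalizedCapacity.choquet (ν : NormalizedCapacity S) (f : S → ℝ)
    (hf : Measurable f) : ℝ :=
  (∫ t in Set.Ioi (0 : ℝ), ν.level f hf t) +
    ∫ t in Set.Iic (0 : ℝ), (ν.level f hf t - ν.toFun ⟨Set.univ, MeasurableSet.univ⟩)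

end Capacity

end RieszChoquet

open RieszChoquet

/-! The order ideals that contain `N` and are maximal among those avoiding a given positive vector
are prime, and a prime ideal `M` with `e ∉ M` orders `X / M` totally; cutting `ℝ • e` by this order
gives a lattice homomorphism `ξ : X → ℝ` with `ξ e = 1` and `ξ = 0` on `M`. Such a homomorphism is
an extreme point of the positive functionals on `N^⊥` normalized at `e`
(`mem_extremePoints_of_map_sup`). If `(w - ε e)⁺ ∉ N`, choosing `M` to avoid this vector yields
`ξ w ≥ ε`. Hence `y ≤ z` at every lattice homomorphism in `E_N` means `(y - z - ε e)⁺ ∈ N` for all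
`ε > 0`, and so `V y ≤ V z` (`UnitModular.le_of_forall_hom`).

Unit-modularity and unit-additivity make `V` additive over horizontal layers:
`V (x ⊓ b e) - V (x ⊓ a e) = V ((x - a e)⁺ ⊓ (b - a) e)`. If `f ≤ m e` and `g ≥ δ` where `f > 0`,
thin layers of `f` lie below all layers of `g` of at least the same thickness, and counting layers
gives `δ V f ≤ m V g` (`UnitModular.mul_le_mul_of_support`). For the set function
`ν A = inf {V g / δ : g ≥ 0, δ > 0, g ≥ δ on A}` this shows
`(b - a) ν(x ≥ b) ≤ V (x ⊓ b e) - V (x ⊓ a e) ≤ (b - a) ν(x ≥ a)`,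
and Riemann sums turn these bounds into `V (x ⊓ b e) - V (x ⊓ a e) = ∫ t in a..b, ν(x ≥ t)`.

In the definition of `ν` only the lattice homomorphisms in `A` are tested, so that the converse
description of extreme points as lattice homomorphisms is not needed. -/

namespace RieszChoquet

/-! ### Riemann sums of antitone functions -/

section RealLemmas

/-- If the increments of `F` lie between the lower and upper rectangles of an antitone function,
then `F` is a primitive of it. -/
theorem integral_eq_sub_of_rectangle_bounds {F L : ℝ → ℝ} (hL : Antitone L)
    (hlow : ∀ a b, a < b → L b * (b - a) ≤ F b - F a)
    (hupp : ∀ a b, a < b → F b - F a ≤ L a * (b - a)) {a b : ℝ} (hab : a ≤ b) :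
    ∫ t in a..b, L t = F b - F a := by
  have hint : ∀ s t, IntervalIntegrable L MeasureTheory.volume s t :=
    fun s t => hL.intervalIntegrable
  set D : ℝ → ℝ := fun t => (∫ s in a..t, L s) - F t with hD
  have hstep : ∀ s t, s ≤ t → |D t - D s| ≤ (L s - L t) * (t - s) := by
    intro s t hst
    rcases hst.eq_or_lt with rfl | hst'
    · simp
    have h1 : (∫ u in a..t, L u) - ∫ u in a..s, L u = ∫ u in s..t, L u :=
      intervalIntegral.integral_interval_sub_left (hint _ _) (hint _ _)
    have h2 : ∫ u in s..t, L u ≤ ∫ _ in s..t, L s :=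
      intervalIntegral.integral_mono_on hst (hint _ _) intervalIntegrable_const
        fun u hu => hL hu.1
    have h3 : ∫ _ in s..t, L t ≤ ∫ u in s..t, L u :=
      intervalIntegral.integral_mono_on hst intervalIntegrable_const (hint _ _)
        fun u hu => hL hu.2
    rw [intervalIntegral.integral_const, smul_eq_mul] at h2 h3
    have h4 := hlow s t hst'
    have h5 := hupp s t hst'
    simp only [hD]
    rw [abs_le]
    constructor <;> nlinarith
  -- The errors of the `n + 1` steps of an equidistant partition telescope.
  have hn : ∀ n : ℕ, |D b - D a| * (n + 1 : ℕ) ≤ (L a - L b) * (b - a) := by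
    intro n
    set h : ℝ := (b - a) / (n + 1 : ℕ) with hh
    have hpos : (0 : ℝ) < (n + 1 : ℕ) := by positivity
    have hh0 : 0 ≤ h := div_nonneg (sub_nonneg.2 hab) hpos.le
    have hend : a + ((n + 1 : ℕ) : ℝ) * h = b := by
      rw [hh]; field_simp; ring
    have hsum : ∀ k : ℕ, |D (a + k * h) - D a| ≤ (L a - L (a + k * h)) * h := by
      intro k
      induction k with
      | zero => simp
      | succ k ih =>
        have h1 := hstep (a + k * h) (a + (k + 1 : ℕ) * h) (by push_cast; nlinarith)
        have h2 : a + (k + 1 : ℕ) * h - (a + k * h) = h := by push_cast; ring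
        rw [h2] at h1
        have h3 := abs_sub_le (D (a + (k + 1 : ℕ) * h)) (D (a + k * h)) (D a)
        linarith
    have h1 := hsum (n + 1)
    rw [hend] at h1
    calc _ ≤ (L a - L b) * h * (n + 1 : ℕ) := mul_le_mul_of_nonneg_right h1 hpos.le
      _ = _ := by rw [hh]; field_simp
  have hzero : D b - D a = 0 := by
    by_contra hne
    obtain ⟨n, hn'⟩ := exists_nat_gt ((L a - L b) * (b - a) / |D b - D a|)
    have hp : 0 < |D b - D a| := abs_pos.2 hne
    rw [div_lt_iff₀ hp] at hn'
    have := hn n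
    push_cast at this
    nlinarith
  simp only [hD, intervalIntegral.integral_same] at hzero
  linarith

end RealLemmas

/-! ### Order ideals and lattice homomorphisms -/

section Ideals

/-- The lattice of a Riesz space is distributive, hence modular. -/
theorem inf_sup_eq_of_le {X : Type*} [AddCommGroup X] [Lattice X]
    [IsOrderedAddMonoid X] {a b : X} (hab : a ≤ b) (x : X) : x ⊓ b ⊔ a = (x ⊔ a) ⊓ b := by
  let : DistribLattice X := AddCommGroup.toDistribLattice X
  rw [sup_inf_right, sup_eq_left.2 hab]

variable {X : Type*} [AddCommGroup X] [Lattice X] [Module ℝ X]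

theorem nonneg_of_map_sup {ξ : Module.Dual ℝ X} (hsup : ∀ x y, ξ (x ⊔ y) = max (ξ x) (ξ y))
    {x : X} (hx : 0 ≤ x) : 0 ≤ ξ x := by
  have h := hsup x 0
  rw [sup_eq_left.2 hx, map_zero] at h
  rw [h]
  exact le_max_right _ _

theorem pairing_combo {e : X} (a b : ℝ) (η ζ : WeakStarDual e) (x : X) :
    pairing x (a • η + b • ζ) = a * pairing x η + b * pairing x ζ := rfl

theorem pairing_add {e : X} (x y : X) (ξ : WeakStarDual e) :
    pairing (x + y) ξ = pairing x ξ + pairing y ξ :=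
  map_add ((normDual e).subtype ξ) x y

theorem pairing_sub {e : X} (x y : X) (ξ : WeakStarDual e) :
    pairing (x - y) ξ = pairing x ξ - pairing y ξ :=
  map_sub ((normDual e).subtype ξ) x y

theorem pairing_smul {e : X} (c : ℝ) (x : X) (ξ : WeakStarDual e) :
    pairing (c • x) ξ = c * pairing x ξ :=
  map_smul ((normDual e).subtype ξ) c x

theorem pairing_zero {e : X} (ξ : WeakStarDual e) : pairing (0 : X) ξ = 0 :=
  map_zero ((normDual e).subtype ξ)

/-- The preorder `x ≤ y` modulo the order ideal `M`, encoded as `(x - y)⁺ ∈ M`. -/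
def LeMod (M : Submodule ℝ X) (x y : X) : Prop := (x - y) ⊔ 0 ∈ M

theorem LeMod.neg {M : Submodule ℝ X} {x y : X} (h : LeMod M x y) : LeMod M (-y) (-x) := by
  unfold LeMod at h ⊢
  rwa [neg_sub_neg]

/-- `r` is the value at `x` of the functional that cuts the line `ℝ • e` by the order
modulo `M`. -/
def IsCut (M : Submodule ℝ X) (e x : X) (r : ℝ) : Prop :=
  (∀ c, r < c → LeMod M x (c • e)) ∧ ∀ c, c < r → LeMod M (c • e) x

theorem IsCut.neg {M : Submodule ℝ X} {e x : X} {r : ℝ} (hr : IsCut M e x r) :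
    IsCut M e (-x) (-r) := by
  constructor
  · intro c hc
    simpa using (hr.2 (-c) (by linarith)).neg
  · intro c hc
    simpa using (hr.1 (-c) (by linarith)).neg

section OrderedModule

variable [IsOrderedModule ℝ X]

theorem abs_smul_le_smul_abs (c : ℝ) (x : X) : |c • x| ≤ |c| • |x| := by
  rcases le_total 0 c with hc | hc
  · rw [abs_of_nonneg hc]
    exact abs_le'.2 ⟨smul_le_smul_of_nonneg_left (le_abs_self x) hc, by
      rw [← smul_neg]; exact smul_le_smul_of_nonneg_left (neg_le_abs x) hc⟩
  · rw [abs_of_nonpos hc]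
    have hc' : 0 ≤ -c := neg_nonneg.2 hc
    refine abs_le'.2 ⟨?_, ?_⟩
    · rw [← neg_smul_neg]; exact smul_le_smul_of_nonneg_left (neg_le_abs x) hc'
    · rw [← neg_smul]; exact smul_le_smul_of_nonneg_left (le_abs_self x) hc'

/-- Disjointness is stable under scaling. -/
theorem smul_inf_smul_le {a b : X} (hab : a ⊓ b = 0) {k : ℝ} (hk : 0 ≤ k) :
    k • a ⊓ k • b ≤ 0 := by
  rcases hk.eq_or_lt with rfl | hk
  · simp
  have h : k⁻¹ • (k • a ⊓ k • b) ≤ a ⊓ b := by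
    refine le_inf ?_ ?_
    · have := smul_le_smul_of_nonneg_left (inf_le_left : k • a ⊓ k • b ≤ k • a) (inv_pos.2 hk).le
      rwa [inv_smul_smul₀ hk.ne'] at this
    · have := smul_le_smul_of_nonneg_left (inf_le_right : k • a ⊓ k • b ≤ k • b) (inv_pos.2 hk).le
      rwa [inv_smul_smul₀ hk.ne'] at this
  rw [hab] at h
  have := smul_le_smul_of_nonneg_left h hk.le
  rwa [smul_inv_smul₀ hk.ne', smul_zero] at this

end OrderedModule

variable [IsOrderedAddMonoid X]

theorem IsOrderIdeal.mem_of_le {M : Submodule ℝ X} (hM : IsOrderIdeal M) {x y : X}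
    (hx : 0 ≤ x) (hxy : x ≤ y) (hy : y ∈ M) : x ∈ M :=
  hM x y hy (by rwa [abs_of_nonneg hx, abs_of_nonneg (hx.trans hxy)])

theorem IsOrderIdeal.abs_mem {M : Submodule ℝ X} (hM : IsOrderIdeal M) {x : X}
    (hx : x ∈ M) : |x| ∈ M :=
  hM _ x hx (by rw [abs_abs])

theorem IsUnitVector.exists_abs_le {e : X} (he : IsUnitVector e) (x : X) :
    ∃ c : ℝ, 0 ≤ c ∧ |x| ≤ c • e := by
  obtain ⟨c, hc, h1, h2⟩ := he.2 x
  exact ⟨c, hc, abs_le'.2 ⟨h2, neg_le.1 h1⟩⟩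

theorem abs_le_of_abs_le_smul {e : X} {ξ : Module.Dual ℝ X} (hpos : ∀ x, 0 ≤ x → 0 ≤ ξ x)
    (h1 : ξ e = 1) {x : X} {c : ℝ} (h : |x| ≤ c • e) : |ξ x| ≤ c := by
  have hmono : ∀ x y, x ≤ y → ξ x ≤ ξ y := by
    intro x y hxy
    have := hpos (y - x) (sub_nonneg.2 hxy)
    rw [map_sub] at this
    linarith
  have hc : ξ (c • e) = c := by rw [map_smul, h1, smul_eq_mul, mul_one]
  refine abs_le'.2 ⟨hc ▸ hmono _ _ ((le_abs_self x).trans h), ?_⟩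
  rw [← map_neg]
  exact hc ▸ hmono _ _ ((neg_le_abs x).trans h)

theorem mem_normDual_of_nonneg {e : X} (he : IsUnitVector e) {ξ : Module.Dual ℝ X}
    (hpos : ∀ x, 0 ≤ x → 0 ≤ ξ x) (h1 : ξ e = 1) : ξ ∈ normDual e := by
  refine ⟨1, fun x => ?_⟩
  rw [one_mul]
  exact le_csInf (he.exists_abs_le x) fun c hc => abs_le_of_abs_le_smul hpos h1 hc.2

/-- Lattice homomorphisms are extreme: if `ξ` is a proper convex combination of `η` and `ζ`, then
`η` vanishes on the order ideal `ker ξ`, whose translates by multiples of `e` cover `X`. -/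
theorem mem_extremePoints_of_map_sup {e : X} {N : Submodule ℝ X} {ξ : WeakStarDual e}
    (hsup : ∀ x y, pairing (x ⊔ y) ξ = max (pairing x ξ) (pairing y ξ))
    (h1 : pairing e ξ = 1) (hN : ∀ x ∈ N, pairing x ξ = 0) :
    ξ ∈ Set.extremePoints ℝ (positiveSphere e ∩ annihilator e N) := by
  have hpos : ∀ x, 0 ≤ x → 0 ≤ pairing x ξ := fun x hx => nonneg_of_map_sup hsup hx
  rw [mem_extremePoints_iff_left]
  refine ⟨⟨⟨hpos, h1⟩, hN⟩, ?_⟩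
  rintro η ⟨⟨hη, hη1⟩, -⟩ ζ ⟨⟨hζ, -⟩, -⟩ ⟨a, b, ha, hb, -, hab⟩
  have hker : ∀ x, pairing x ξ = 0 → pairing x η = 0 := by
    intro x hx
    have h2 : pairing |x| ξ = 0 := by
      have h3 : pairing (-x) ξ = 0 := by
        rw [← zero_sub, pairing_sub, pairing_zero, hx, sub_zero]
      rw [abs, hsup, hx, h3, max_self]
    rw [← hab, pairing_combo] at h2
    have h3 : pairing |x| η = 0 := by
      have := hη |x| (abs_nonneg x)
      have := mul_nonneg hb.le (hζ |x| (abs_nonneg x))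
      nlinarith
    have h4 := hη (|x| - x) (sub_nonneg.2 (le_abs_self x))
    have h5 := hη (|x| + x) (neg_le_iff_add_nonneg'.1 (neg_le.1 (neg_le_abs x)))
    rw [pairing_sub] at h4
    rw [pairing_add] at h5
    linarith
  have hval : ∀ x, pairing x η = pairing x ξ := by
    intro x
    have h2 := hker (x - pairing x ξ • e) (by rw [pairing_sub, pairing_smul, h1]; ring)
    rw [pairing_sub, pairing_smul, hη1] at h2
    linarith
  exact Subtype.ext (LinearMap.ext hval)

theorem LeMod.of_sub_le {M : Submodule ℝ X} (hM : IsOrderIdeal M) {x y m : X} (hm : m ∈ M)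
    (h : x - y ≤ m) : LeMod M x y :=
  hM.mem_of_le le_sup_right (sup_le (h.trans (le_abs_self m)) (abs_nonneg m)) (hM.abs_mem hm)

theorem LeMod.of_le {M : Submodule ℝ X} (hM : IsOrderIdeal M) {x y : X} (h : x ≤ y) :
    LeMod M x y :=
  LeMod.of_sub_le hM M.zero_mem (sub_nonpos.2 h)

theorem LeMod.trans {M : Submodule ℝ X} (hM : IsOrderIdeal M) {x y z : X}
    (h₁ : LeMod M x y) (h₂ : LeMod M y z) : LeMod M x z :=
  LeMod.of_sub_le hM (M.add_mem h₁ h₂)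
    (by rw [← sub_add_sub_cancel x y z]; exact add_le_add le_sup_left le_sup_left)

theorem LeMod.add {M : Submodule ℝ X} (hM : IsOrderIdeal M) {x y x' y' : X}
    (h₁ : LeMod M x y) (h₂ : LeMod M x' y') : LeMod M (x + x') (y + y') :=
  LeMod.of_sub_le hM (M.add_mem h₁ h₂)
    (by rw [add_sub_add_comm]; exact add_le_add le_sup_left le_sup_left)

theorem IsCut.add {M : Submodule ℝ X} (hM : IsOrderIdeal M) {e x y : X} {r s : ℝ}
    (hr : IsCut M e x r) (hs : IsCut M e y s) : IsCut M e (x + y) (r + s) := by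
  constructor
  · intro c hc
    have h := (hr.1 (r + (c - r - s) / 2) (by linarith)).add hM
      (hs.1 (s + (c - r - s) / 2) (by linarith))
    rwa [← add_smul, show r + (c - r - s) / 2 + (s + (c - r - s) / 2) = c by ring] at h
  · intro c hc
    have h := (hr.2 (r + (c - r - s) / 2) (by linarith)).add hM
      (hs.2 (s + (c - r - s) / 2) (by linarith))
    rwa [← add_smul, show r + (c - r - s) / 2 + (s + (c - r - s) / 2) = c by ring] at h

variable [IsOrderedModule ℝ X]

/-- The order ideal generated by `M` and `a`, for an order ideal `M` and `a ≥ 0`. -/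
def idealAdjoin (M : Submodule ℝ X) (a : X) : Submodule ℝ X where
  carrier := {x | ∃ m ∈ M, ∃ k : ℝ, 0 ≤ k ∧ |x| ≤ m + k • a}
  zero_mem' := ⟨0, M.zero_mem, 0, le_rfl, by simp⟩
  add_mem' := by
    rintro x y ⟨m, hm, k, hk, hx⟩ ⟨m', hm', k', hk', hy⟩
    refine ⟨m + m', M.add_mem hm hm', k + k', add_nonneg hk hk', (abs_add_le x y).trans ?_⟩
    calc |x| + |y| ≤ (m + k • a) + (m' + k' • a) := add_le_add hx hy
      _ = _ := by rw [add_smul]; abel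
  smul_mem' := by
    rintro c x ⟨m, hm, k, hk, hx⟩
    refine ⟨|c| • m, M.smul_mem _ hm, |c| * k, mul_nonneg (abs_nonneg c) hk,
      (abs_smul_le_smul_abs c x).trans ?_⟩
    calc |c| • |x| ≤ |c| • (m + k • a) := smul_le_smul_of_nonneg_left hx (abs_nonneg c)
      _ = _ := by rw [smul_add, mul_smul]

theorem isOrderIdeal_idealAdjoin (M : Submodule ℝ X) (a : X) : IsOrderIdeal (idealAdjoin M a) := by
  rintro x y ⟨m, hm, k, hk, hy⟩ hxy
  exact ⟨m, hm, k, hk, hxy.trans hy⟩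

theorem le_idealAdjoin {M : Submodule ℝ X} (hM : IsOrderIdeal M) (a : X) :
    M ≤ idealAdjoin M a :=
  fun x hx => ⟨|x|, hM.abs_mem hx, 0, le_rfl, by simp⟩

theorem mem_idealAdjoin {M : Submodule ℝ X} {a : X} (ha : 0 ≤ a) : a ∈ idealAdjoin M a :=
  ⟨0, M.zero_mem, 1, zero_le_one, by simp [abs_of_nonneg ha]⟩

/-- Prime ideal theorem: an order ideal that does not contain `u ≥ 0` extends to an order ideal
that still avoids `u` and contains one of any two disjoint vectors. -/
theorem exists_prime_ideal {N : Submodule ℝ X} (hN : IsOrderIdeal N) {u : X} (hu0 : 0 ≤ u)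
    (hu : u ∉ N) :
    ∃ M : Submodule ℝ X, IsOrderIdeal M ∧ N ≤ M ∧ u ∉ M ∧
      ∀ a b : X, a ⊓ b = 0 → a ∈ M ∨ b ∈ M := by
  obtain ⟨M, hNM, hmax⟩ := zorn_le_nonempty₀ {M : Submodule ℝ X | IsOrderIdeal M ∧ u ∉ M} (by
    intro c hc hchain y hy
    refine ⟨sSup c, ⟨?_, ?_⟩, fun z hz => le_sSup hz⟩
    · intro x z hz hxz
      rw [Submodule.mem_sSup_of_directed ⟨y, hy⟩ hchain.directedOn] at hz ⊢
      obtain ⟨P, hP, hzP⟩ := hz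
      exact ⟨P, hP, (hc hP).1 x z hzP hxz⟩
    · rw [Submodule.mem_sSup_of_directed ⟨y, hy⟩ hchain.directedOn]
      rintro ⟨P, hP, huP⟩
      exact (hc hP).2 huP) N ⟨hN, hu⟩
  obtain ⟨hM, huM⟩ := hmax.prop
  refine ⟨M, hM, hNM, huM, fun a b hab => ?_⟩
  have ha : 0 ≤ a := hab ▸ inf_le_left
  have hb : 0 ≤ b := hab ▸ inf_le_right
  by_contra! hcon
  -- By maximality, adjoining a vector outside `M` captures `u`.
  have key : ∀ z : X, 0 ≤ z → z ∉ M → u ∈ idealAdjoin M z := by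
    intro z hz hzM
    by_contra hnot
    exact hzM (hmax.le_of_ge ⟨isOrderIdeal_idealAdjoin M z, hnot⟩ (le_idealAdjoin hM z)
      (mem_idealAdjoin hz))
  obtain ⟨m, hm, k, hk, h1⟩ := key a ha hcon.1
  obtain ⟨m', hm', k', hk', h2⟩ := key b hb hcon.2
  rw [abs_of_nonneg hu0] at h1 h2
  have hs : |m| + |m'| ∈ M := M.add_mem (hM.abs_mem hm) (hM.abs_mem hm')
  refine huM (hM.mem_of_le hu0 (?_ : u ≤ |m| + |m'|) hs)
  have h3 : u ≤ (|m| + |m'|) + (k + k') • a := by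
    refine h1.trans (add_le_add ((le_abs_self m).trans (le_add_of_nonneg_right (abs_nonneg _))) ?_)
    exact smul_le_smul_of_nonneg_right (by linarith) ha
  have h4 : u ≤ (|m| + |m'|) + (k + k') • b := by
    refine h2.trans (add_le_add ((le_abs_self m').trans (le_add_of_nonneg_left (abs_nonneg _))) ?_)
    exact smul_le_smul_of_nonneg_right (by linarith) hb
  have h5 : u - (|m| + |m'|) ≤ (k + k') • a ⊓ (k + k') • b :=
    le_inf (sub_le_iff_le_add'.2 h3) (sub_le_iff_le_add'.2 h4)
  exact sub_nonpos.1 (h5.trans (smul_inf_smul_le hab (add_nonneg hk hk')))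

theorem LeMod.smul {M : Submodule ℝ X} (hM : IsOrderIdeal M) {x y : X} (h : LeMod M x y)
    {c : ℝ} (hc : 0 ≤ c) : LeMod M (c • x) (c • y) :=
  LeMod.of_sub_le hM (M.smul_mem c h)
    (by rw [← smul_sub]; exact smul_le_smul_of_nonneg_left le_sup_left hc)

theorem LeMod.le_of_smul {M : Submodule ℝ X} (hM : IsOrderIdeal M) {e : X} (he0 : 0 ≤ e)
    (he : e ∉ M) {c d : ℝ} (h : LeMod M (c • e) (d • e)) : c ≤ d := by
  by_contra! hlt
  have h0 : 0 < c - d := sub_pos.2 hlt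
  have h1 : (c - d) • e ∈ M :=
    hM.mem_of_le (smul_nonneg h0.le he0) (by rw [sub_smul]; exact le_sup_left) h
  exact he ((M.smul_mem_iff h0.ne').1 h1)

/-- Cut values respect the order modulo `M`. -/
theorem IsCut.le_of_leMod {M : Submodule ℝ X} (hM : IsOrderIdeal M) {e : X} (he0 : 0 ≤ e)
    (he : e ∉ M) {x y : X} {r s : ℝ} (hr : IsCut M e x r) (hs : IsCut M e y s)
    (h : LeMod M x y) : r ≤ s := by
  by_contra! hlt
  obtain ⟨c, hsc, hcr⟩ := exists_between hlt
  obtain ⟨d, hcd, hdr⟩ := exists_between hcr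
  exact absurd (LeMod.le_of_smul hM he0 he
    (((hr.2 d hdr).trans hM h).trans hM (hs.1 c hsc))) (not_le.2 hcd)

theorem IsCut.unique {M : Submodule ℝ X} (hM : IsOrderIdeal M) {e : X} (he0 : 0 ≤ e)
    (he : e ∉ M) {x : X} {r s : ℝ} (hr : IsCut M e x r) (hs : IsCut M e x s) : r = s :=
  le_antisymm (hr.le_of_leMod hM he0 he hs (LeMod.of_le hM le_rfl))
    (hs.le_of_leMod hM he0 he hr (LeMod.of_le hM le_rfl))

theorem isCut_smul_self {M : Submodule ℝ X} (hM : IsOrderIdeal M) {e : X} (he0 : 0 ≤ e) (r : ℝ) :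
    IsCut M e (r • e) r :=
  ⟨fun _ hc => LeMod.of_le hM (smul_le_smul_of_nonneg_right hc.le he0),
    fun _ hc => LeMod.of_le hM (smul_le_smul_of_nonneg_right hc.le he0)⟩

theorem IsCut.smul_of_pos {M : Submodule ℝ X} (hM : IsOrderIdeal M) {e x : X} {r : ℝ}
    (hr : IsCut M e x r) {k : ℝ} (hk : 0 < k) : IsCut M e (k • x) (k * r) := by
  constructor
  · intro c hc
    have h := (hr.1 (c / k) (by rwa [lt_div_iff₀' hk])).smul hM hk.le
    rwa [smul_smul, mul_div_cancel₀ _ hk.ne'] at h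
  · intro c hc
    have h := (hr.2 (c / k) (by rwa [div_lt_iff₀' hk])).smul hM hk.le
    rwa [smul_smul, mul_div_cancel₀ _ hk.ne'] at h

theorem IsCut.smul {M : Submodule ℝ X} (hM : IsOrderIdeal M) {e x : X} (he0 : 0 ≤ e) {r : ℝ}
    (hr : IsCut M e x r) (k : ℝ) : IsCut M e (k • x) (k * r) := by
  rcases lt_trichotomy k 0 with hk | rfl | hk
  · simpa using (hr.smul_of_pos hM (neg_pos.2 hk)).neg
  · simpa using isCut_smul_self hM he0 0
  · exact hr.smul_of_pos hM hk

theorem exists_isCut {M : Submodule ℝ X} (hM : IsOrderIdeal M)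
    (htotal : ∀ x y : X, LeMod M x y ∨ LeMod M y x) {e : X} (he : IsUnitVector e) (he0 : 0 ≤ e)
    (heM : e ∉ M) (x : X) : ∃ r, IsCut M e x r := by
  obtain ⟨c, hc0, hc1, hc2⟩ := he.2 x
  set S : Set ℝ := {t | LeMod M x (t • e)} with hS
  have hne : S.Nonempty := ⟨c, LeMod.of_le hM hc2⟩
  have hbdd : BddBelow S := by
    refine ⟨-c, fun t ht => ?_⟩
    refine LeMod.le_of_smul hM he0 heM ((LeMod.of_le hM ?_).trans hM ht)
    rwa [neg_smul]
  refine ⟨sInf S, fun t ht => ?_, fun t ht => ?_⟩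
  · obtain ⟨s, hs, hst⟩ := exists_lt_of_csInf_lt hne ht
    exact hs.trans hM (LeMod.of_le hM (smul_le_smul_of_nonneg_right hst.le he0))
  · rcases htotal x (t • e) with h | h
    · exact absurd (csInf_le hbdd h) (not_le.2 ht)
    · exact h

theorem IsUnitVector.nonneg {e : X} (he : IsUnitVector e) : 0 ≤ e := by
  obtain ⟨c, hc0, h1, h2⟩ := he.2 e
  have h3 : 0 ≤ (2 * c) • e := by
    rw [two_mul, add_smul]
    exact neg_le_iff_add_nonneg.1 (h1.trans h2)
  rcases hc0.eq_or_lt with rfl | hc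
  · -- For `c = 0` the bounds force `e = 0`.
    simp only [zero_smul, neg_zero] at h1
    exact h1
  · have h4 := smul_le_smul_of_nonneg_left h3 (inv_pos.2 (by positivity : 0 < 2 * c)).le
    rwa [smul_zero, inv_smul_smul₀ (by positivity)] at h4

/-- If `u ≥ 0` is not in the order ideal `N`, some real lattice homomorphism vanishes on `N` and
takes the value `1` at `e`; if `u = (w - ε e)⁺`, this homomorphism is at least `ε` at `w`. -/
theorem exists_lattice_hom {e : X} (he : IsUnitVector e) {N : Submodule ℝ X}
    (hN : IsOrderIdeal N) {w : X} {ε : ℝ} (hw : (w - ε • e) ⊔ 0 ∉ N) :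
    ∃ ξ : Module.Dual ℝ X, (∀ x y, ξ (x ⊔ y) = max (ξ x) (ξ y)) ∧ ξ e = 1 ∧
      (∀ x ∈ N, ξ x = 0) ∧ ε ≤ ξ w := by
  have he0 := he.nonneg
  obtain ⟨M, hM, hNM, huM, hprime⟩ := exists_prime_ideal hN le_sup_right hw
  have heM : e ∉ M := by
    intro h
    obtain ⟨c, hc0, hc1, hc2⟩ := he.2 ((w - ε • e) ⊔ 0)
    exact huM (hM.mem_of_le le_sup_right hc2 (M.smul_mem c h))
  have htotal : ∀ x y : X, LeMod M x y ∨ LeMod M y x := by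
    intro x y
    have h := hprime _ _ (posPart_inf_negPart_eq_zero (x - y))
    rwa [posPart_def, negPart_def, neg_sub] at h
  choose f hf using exists_isCut hM htotal he he0 heM
  let ξ : Module.Dual ℝ X :=
    { toFun := f
      map_add' := fun x y => (hf (x + y)).unique hM he0 heM ((hf x).add hM (hf y))
      map_smul' := fun k x => (hf (k • x)).unique hM he0 heM ((hf x).smul hM he0 k) }
  have hmono : ∀ x y, LeMod M x y → f x ≤ f y :=
    fun x y h => (hf x).le_of_leMod hM he0 heM (hf y) h
  have hsmul : ∀ r : ℝ, f (r • e) = r :=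
    fun r => (hf _).unique hM he0 heM (isCut_smul_self hM he0 r)
  have hsup : ∀ x y, LeMod M x y → f (x ⊔ y) = f y := by
    intro x y h
    refine le_antisymm (hmono _ _ (LeMod.of_sub_le hM h ?_))
      (hmono _ _ (LeMod.of_le hM le_sup_right))
    rw [sup_sub, sub_self]
  refine ⟨ξ, fun x y => ?_, ?_, fun x hx => ?_, ?_⟩
  · change f (x ⊔ y) = max (f x) (f y)
    rcases htotal x y with h | h
    · rw [hsup x y h, max_eq_right (hmono _ _ h)]
    · rw [sup_comm, hsup y x h, max_eq_left (hmono _ _ h)]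
  · have := hsmul 1
    rwa [one_smul] at this
  · have h0 : f 0 = 0 := ξ.map_zero
    refine le_antisymm ?_ ?_
    · exact h0 ▸ hmono x 0 (LeMod.of_sub_le hM (hNM hx) (by simp))
    · exact h0 ▸ hmono 0 x (LeMod.of_sub_le hM (M.neg_mem (hNM hx)) (by simp))
  · have h : LeMod M (ε • e) w := (htotal w (ε • e)).resolve_left huM
    exact hsmul ε ▸ hmono _ _ h

end Ideals

/-! ### Functionals and horizontal layers -/

section Functional

variable {X : Type*} [AddCommGroup X] [Lattice X] [Module ℝ X]

/-- The elements of `E_N` that are lattice homomorphisms. -/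
def latticeHoms (e : X) (N : Submodule ℝ X) : Set (ExtremeFunctionals e N) :=
  {ξ | ∀ x y, evalAt e N (x ⊔ y) ξ = max (evalAt e N x ξ) (evalAt e N y ξ)}

/-- A normalized, monotone, unit-additive, unit-modular and `N`-invariant functional. -/
structure UnitModular (e : X) (N : Submodule ℝ X) (V : X → ℝ) : Prop where
  normalized : ∀ c : ℝ, V (c • e) = c
  monotone : ∀ x y : X, x ≤ y → V x ≤ V y
  unitAdditive : ∀ (x : X) (c : ℝ), 0 ≤ c → V (x + c • e) = V x + V (c • e)
  unitModular : ∀ (x : X) (c : ℝ), V (x ⊔ c • e) + V (x ⊓ c • e) = V x + V (c • e)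
  invariant : ∀ x y : X, x - y ∈ N → V x = V y

variable {e : X} {N : Submodule ℝ X} {V : X → ℝ}

theorem evalAt_unit (ξ : ExtremeFunctionals e N) : evalAt e N e ξ = 1 := ξ.2.1.1.2

theorem evalAt_smul_unit (c : ℝ) (ξ : ExtremeFunctionals e N) : evalAt e N (c • e) ξ = c := by
  have h : evalAt e N (c • e) ξ = c * evalAt e N e ξ :=
    pairing_smul c e ξ.1
  rw [h, evalAt_unit, mul_one]

theorem evalAt_zero (ξ : ExtremeFunctionals e N) : evalAt e N 0 ξ = 0 :=
  pairing_zero ξ.1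

theorem evalAt_sub (x y : X) (ξ : ExtremeFunctionals e N) :
    evalAt e N (x - y) ξ = evalAt e N x ξ - evalAt e N y ξ :=
  pairing_sub x y ξ.1

theorem UnitModular.map_zero (hV : UnitModular e N V) : V 0 = 0 := by
  simpa using hV.normalized 0

theorem UnitModular.nonneg (hV : UnitModular e N V) {x : X} (hx : 0 ≤ x) : 0 ≤ V x :=
  hV.map_zero ▸ hV.monotone 0 x hx

theorem UnitModular.map_add_smul (hV : UnitModular e N V) (x : X) (c : ℝ) :
    V (x + c • e) = V x + c := by
  rcases le_total 0 c with hc | hc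
  · rw [hV.unitAdditive x c hc, hV.normalized]
  · have h := hV.unitAdditive (x + c • e) (-c) (by linarith)
    rw [hV.normalized, neg_smul, add_neg_cancel_right] at h
    linarith

/-- The horizontal layer of `x` of thickness `h` above height `a`. -/
def layer (e x : X) (a h : ℝ) : X := ((x - a • e) ⊔ 0) ⊓ h • e

theorem layer_nonneg [IsOrderedModule ℝ X] (he0 : 0 ≤ e) (x : X) (a : ℝ) {h : ℝ} (hh : 0 ≤ h) :
    0 ≤ layer e x a h :=
  le_inf le_sup_right (smul_nonneg hh he0)

variable [IsOrderedAddMonoid X]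

theorem evalAt_inf {ξ : ExtremeFunctionals e N} (hξ : ξ ∈ latticeHoms e N) (x y : X) :
    evalAt e N (x ⊓ y) ξ = min (evalAt e N x ξ) (evalAt e N y ξ) := by
  have h : evalAt e N (x ⊓ y + x ⊔ y) ξ = evalAt e N (x + y) ξ := by rw [inf_add_sup]
  have hadd : ∀ u v, evalAt e N (u + v) ξ = evalAt e N u ξ + evalAt e N v ξ :=
    fun u v => pairing_add u v ξ.1
  rw [hadd, hadd, hξ] at h
  have := min_add_max (evalAt e N x ξ) (evalAt e N y ξ)
  linarith

theorem evalAt_layer {ξ : ExtremeFunctionals e N} (hξ : ξ ∈ latticeHoms e N) (x : X) (a h : ℝ) :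
    evalAt e N (layer e x a h) ξ = min (max (evalAt e N x ξ - a) 0) h := by
  rw [layer, evalAt_inf hξ, hξ, evalAt_sub, evalAt_smul_unit, evalAt_smul_unit, evalAt_zero]

variable [IsOrderedModule ℝ X]

/-- Additivity of `V` over horizontal layers. -/
theorem UnitModular.map_layer (hV : UnitModular e N V) (he0 : 0 ≤ e) (x : X) {a b : ℝ}
    (hab : a ≤ b) : V (layer e x a (b - a)) = V (x ⊓ b • e) - V (x ⊓ a • e) := by
  have hle : a • e ≤ b • e := smul_le_smul_of_nonneg_right hab he0
  have h1 := hV.unitModular (x ⊓ b • e) a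
  rw [inf_assoc, inf_eq_right.2 hle, hV.normalized] at h1
  have h2 : x ⊓ b • e ⊔ a • e = layer e x a (b - a) + a • e := by
    rw [layer, inf_add, sup_add, sub_add_cancel, zero_add, sub_smul, sub_add_cancel,
      inf_sup_eq_of_le hle]
  rw [h2, hV.map_add_smul] at h1
  linarith

/-- The order on `V` is decided by the lattice homomorphisms in `E_N`. -/
theorem UnitModular.le_of_forall_hom (hV : UnitModular e N V) (he : IsUnitVector e)
    (hN : IsOrderIdeal N) {y z : X}
    (h : ∀ ξ ∈ latticeHoms e N, evalAt e N y ξ ≤ evalAt e N z ξ) : V y ≤ V z := by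
  refine le_of_forall_pos_le_add fun ε hε => ?_
  -- Otherwise some lattice homomorphism in `E_N` would be at least `ε` at `y - z`.
  have hmem : (y - z - ε • e) ⊔ 0 ∈ N := by
    by_contra hnot
    obtain ⟨ξ, hsup, h1, hvan, hw⟩ := exists_lattice_hom he hN hnot
    let ξ' : WeakStarDual e :=
      ⟨ξ, mem_normDual_of_nonneg he (fun x hx => nonneg_of_map_sup hsup hx) h1⟩
    have hext : ξ' ∈ Set.extremePoints ℝ (positiveSphere e ∩ annihilator e N) :=
      mem_extremePoints_of_map_sup hsup h1 hvan
    have h2 : ξ y ≤ ξ z := h ⟨ξ', hext⟩ hsup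
    rw [map_sub] at hw
    linarith
  calc V y ≤ V (z + ε • e + ((y - z - ε • e) ⊔ 0)) := by
        refine hV.monotone _ _ ?_
        rw [← sub_le_iff_le_add', ← sub_sub]
        exact le_sup_left
    _ = V (z + ε • e) := hV.invariant _ _ (by rwa [add_sub_cancel_left])
    _ = V z + ε := hV.map_add_smul z ε

theorem UnitModular.sum_layer (hV : UnitModular e N V) (he0 : 0 ≤ e) {x : X} (hx : 0 ≤ x)
    {h : ℝ} (hh : 0 ≤ h) (n : ℕ) :
    ∑ i ∈ Finset.range n, V (layer e x (i * h) h) = V (x ⊓ (n * h) • e) := by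
  have hi : ∀ i : ℕ, V (layer e x (i * h) h) =
      V (x ⊓ ((i + 1 : ℕ) * h) • e) - V (x ⊓ (i * h) • e) := by
    intro i
    rw [← hV.map_layer he0 x (by push_cast; nlinarith)]
    congr 2
    push_cast
    ring
  simp_rw [hi]
  rw [Finset.sum_range_sub (fun i : ℕ => V (x ⊓ ((i : ℝ) * h) • e))]
  simp [inf_eq_right.2 hx, hV.map_zero]

/-- If `f ≤ m e`, and `g ≥ δ` at every point where `f > 0`, then `δ V f ≤ m V g`. -/
theorem UnitModular.mul_le_mul_of_support (hV : UnitModular e N V) (he : IsUnitVector e)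
    (hN : IsOrderIdeal N) {f g : X} (hf : 0 ≤ f) (hg : 0 ≤ g) {m δ : ℝ} (hm : 0 < m) (hδ : 0 < δ)
    (hfm : f ≤ m • e)
    (hfg : ∀ ξ ∈ latticeHoms e N, 0 < evalAt e N f ξ → δ ≤ evalAt e N g ξ) :
    δ * V f ≤ m * V g := by
  have he0 := he.nonneg
  have hcount : ∀ k l : ℕ, 0 < k → 0 < l → m * l ≤ δ * k → l * V f ≤ k * V g := by
    intro k l hk hl hkl
    have hk' : (0 : ℝ) < k := Nat.cast_pos.2 hk
    have hl' : (0 : ℝ) < l := Nat.cast_pos.2 hl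
    have hthin : m / k ≤ δ / l := by rwa [div_le_div_iff₀ hk' hl']
    have hlayer : ∀ i ∈ Finset.range k, ∀ j ∈ Finset.range l,
        V (layer e f (i * (m / k)) (m / k)) ≤ V (layer e g (j * (δ / l)) (δ / l)) := by
      intro i _ j hj
      refine hV.le_of_forall_hom he hN fun ξ hξ => ?_
      rw [evalAt_layer hξ, evalAt_layer hξ]
      have hi0 : 0 ≤ (i : ℝ) * (m / k) := by positivity
      have hd0 : 0 < δ / l := by positivity
      rcases le_or_gt (evalAt e N f ξ) 0 with h0 | h0
      · rw [max_eq_right (by linarith)]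
        exact (min_le_left _ _).trans (le_min (le_max_right _ _) hd0.le)
      · have hgδ := hfg ξ hξ h0
        have hj' : ((j : ℝ) + 1) * (δ / l) ≤ l * (δ / l) :=
          mul_le_mul_of_nonneg_right (by exact_mod_cast Finset.mem_range.1 hj) hd0.le
        rw [mul_div_cancel₀ _ hl'.ne'] at hj'
        refine (min_le_right _ _).trans (hthin.trans (le_min ((?_ : _ ≤ _).trans
          (le_max_left _ _)) le_rfl))
        linarith
    have hVf : ∑ i ∈ Finset.range k, V (layer e f (i * (m / k)) (m / k)) = V f := by
      rw [hV.sum_layer he0 hf (by positivity), mul_div_cancel₀ _ hk'.ne', inf_eq_left.2 hfm]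
    have hVg : ∑ j ∈ Finset.range l, V (layer e g (j * (δ / l)) (δ / l)) ≤ V g := by
      rw [hV.sum_layer he0 hg (by positivity)]
      exact hV.monotone _ _ inf_le_left
    calc (l : ℝ) * V f
        = ∑ i ∈ Finset.range k, ∑ _j ∈ Finset.range l,
            V (layer e f (i * (m / k)) (m / k)) := by
          simp [← hVf, Finset.mul_sum]
      _ ≤ ∑ _i ∈ Finset.range k, ∑ j ∈ Finset.range l,
            V (layer e g (j * (δ / l)) (δ / l)) :=
          Finset.sum_le_sum fun i hi => Finset.sum_le_sum fun j hj => hlayer i hi j hj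
      _ = k * ∑ j ∈ Finset.range l, V (layer e g (j * (δ / l)) (δ / l)) := by simp
      _ ≤ k * V g := mul_le_mul_of_nonneg_left hVg hk'.le
  have hg0 := hV.nonneg hg
  by_contra! hlt
  -- With `l` layers of `g` and `k = ⌈m l / δ⌉` of `f`, the ratio `k / l` is within `1 / l`
  -- of `m / δ`.
  obtain ⟨l, hl⟩ := exists_nat_gt (δ * V g / (δ * V f - m * V g))
  rw [div_lt_iff₀ (sub_pos.2 hlt)] at hl
  have hl0 : 0 < l := by
    rcases Nat.eq_zero_or_pos l with rfl | h
    · rw [Nat.cast_zero, zero_mul] at hl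
      exact absurd hl (not_lt.2 (mul_nonneg hδ.le hg0))
    · exact h
  have hl' : (0 : ℝ) < l := Nat.cast_pos.2 hl0
  have hq : 0 < m * l / δ := by positivity
  have h1 := hcount ⌈m * l / δ⌉₊ l (Nat.ceil_pos.2 hq) hl0
    (by have := Nat.le_ceil (m * l / δ); rwa [div_le_iff₀' hδ] at this)
  have h2 := (Nat.ceil_lt_add_one hq.le).le
  have h3 : (l : ℝ) * V f ≤ (m * l / δ + 1) * V g :=
    h1.trans (mul_le_mul_of_nonneg_right h2 hg0)
  have h4 : δ * (l * V f) ≤ (m * l + δ) * V g := by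
    calc δ * (l * V f) ≤ δ * ((m * l / δ + 1) * V g) := mul_le_mul_of_nonneg_left h3 hδ.le
      _ = _ := by field_simp
  nlinarith

end Functional

/-! ### The capacity of a functional -/

section OuterCapacity

variable {X : Type*} [AddCommGroup X] [Lattice X] [Module ℝ X]

/-- The ratios `V g / δ` with `g ≥ 0`, `δ > 0` and `g ≥ δ` at all lattice homomorphisms in `A`. -/
def majorantRatios (e : X) (N : Submodule ℝ X) (V : X → ℝ)
    (A : Set (ExtremeFunctionals e N)) : Set ℝ :=
  {r | ∃ (g : X) (δ : ℝ), 0 ≤ g ∧ 0 < δ ∧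
    (∀ ξ ∈ A, ξ ∈ latticeHoms e N → δ ≤ evalAt e N g ξ) ∧ r = V g / δ}

variable {e : X} {N : Submodule ℝ X} {V : X → ℝ}

theorem UnitModular.majorantRatios_nonneg (hV : UnitModular e N V)
    {A : Set (ExtremeFunctionals e N)} {r : ℝ} (hr : r ∈ majorantRatios e N V A) : 0 ≤ r := by
  obtain ⟨g, δ, hg, hδ, -, rfl⟩ := hr
  exact div_nonneg (hV.nonneg hg) hδ.le

theorem UnitModular.bddBelow_majorantRatios (hV : UnitModular e N V)
    (A : Set (ExtremeFunctionals e N)) : BddBelow (majorantRatios e N V A) :=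
  ⟨0, fun _ hr => hV.majorantRatios_nonneg hr⟩

theorem UnitModular.one_mem_majorantRatios (hV : UnitModular e N V) (he0 : 0 ≤ e)
    (A : Set (ExtremeFunctionals e N)) : (1 : ℝ) ∈ majorantRatios e N V A := by
  refine ⟨e, 1, he0, one_pos, fun ξ _ _ => (evalAt_unit ξ).ge, ?_⟩
  have := hV.normalized 1
  rw [one_smul] at this
  rw [this, div_one]

variable [IsOrderedAddMonoid X] [IsOrderedModule ℝ X]

/-- The capacity `A ↦ inf {V g / δ : g ≥ 0, δ > 0, g ≥ δ on A}`, where the last condition is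
imposed at the lattice homomorphisms in `A` only. -/
noncomputable def UnitModular.capacity (hV : UnitModular e N V) (he : IsUnitVector e)
    (hN : IsOrderIdeal N) : NormalizedCapacity (ExtremeFunctionals e N) where
  toFun A := sInf (majorantRatios e N V A.1)
  mono' := by
    intro A B hAB
    refine csInf_le_csInf (hV.bddBelow_majorantRatios _)
      ⟨1, hV.one_mem_majorantRatios he.nonneg _⟩ ?_
    rintro r ⟨g, δ, hg, hδ, h, rfl⟩
    exact ⟨g, δ, hg, hδ, fun ξ hξ => h ξ (hAB hξ), rfl⟩
  empty' := by
    refine le_antisymm (csInf_le (hV.bddBelow_majorantRatios _)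
      ⟨0, 1, le_rfl, one_pos, fun ξ hξ => absurd hξ (Set.notMem_empty ξ), ?_⟩)
      (Real.sInf_nonneg fun r hr => hV.majorantRatios_nonneg hr)
    rw [hV.map_zero, zero_div]
  univ' := by
    refine le_antisymm (csInf_le (hV.bddBelow_majorantRatios _)
      (hV.one_mem_majorantRatios he.nonneg _))
      (le_csInf ⟨1, hV.one_mem_majorantRatios he.nonneg _⟩ ?_)
    rintro r ⟨g, δ, hg, hδ, h, rfl⟩
    rw [le_div_iff₀ hδ, one_mul, ← hV.normalized δ]
    refine hV.le_of_forall_hom he hN fun ξ hξ => ?_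
    rw [evalAt_smul_unit]
    exact h ξ (Set.mem_univ ξ) hξ

theorem UnitModular.level_mul_le (hV : UnitModular e N V) (he : IsUnitVector e)
    (hN : IsOrderIdeal N) (x : X) {a b : ℝ} (hab : a < b) :
    (hV.capacity he hN).level (evalAt e N x) (measurable_evalAt e N x) b * (b - a) ≤
      V (x ⊓ b • e) - V (x ⊓ a • e) := by
  have h0 : 0 < b - a := sub_pos.2 hab
  rw [← hV.map_layer he.nonneg x hab.le, ← le_div_iff₀ h0]
  refine csInf_le (hV.bddBelow_majorantRatios _)
    ⟨layer e x a (b - a), b - a, layer_nonneg he.nonneg x a h0.le, h0, fun ξ hξ hhom => ?_, rfl⟩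
  rw [evalAt_layer hhom]
  have hξ' : b ≤ evalAt e N x ξ := hξ
  exact le_min (le_max_of_le_left (by linarith)) le_rfl

theorem UnitModular.le_level_mul (hV : UnitModular e N V) (he : IsUnitVector e)
    (hN : IsOrderIdeal N) (x : X) {a b : ℝ} (hab : a < b) :
    V (x ⊓ b • e) - V (x ⊓ a • e) ≤
      (hV.capacity he hN).level (evalAt e N x) (measurable_evalAt e N x) a * (b - a) := by
  have h0 : 0 < b - a := sub_pos.2 hab
  rw [← hV.map_layer he.nonneg x hab.le, ← div_le_iff₀ h0]
  refine le_csInf ⟨1, hV.one_mem_majorantRatios he.nonneg _⟩ ?_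
  rintro r ⟨g, δ, hg, hδ, h, rfl⟩
  rw [div_le_div_iff₀ h0 hδ, mul_comm (V _), mul_comm (V g)]
  refine hV.mul_le_mul_of_support he hN (layer_nonneg he.nonneg x a h0.le) hg h0 hδ inf_le_right
    fun ξ hξ hpos => h ξ ?_ hξ
  rw [evalAt_layer hξ] at hpos
  have h1 : 0 < max (evalAt e N x ξ - a) 0 := hpos.trans_le (min_le_left _ _)
  have h2 := (lt_max_iff.1 h1).resolve_right (lt_irrefl 0)
  exact (sub_pos.1 h2).le

end OuterCapacity

/-! ### Choquet integrals of bounded functions -/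

section Choquet

variable {S : Type*} [MeasurableSpace S]

theorem NormalizedCapacity.level_antitone (ν : NormalizedCapacity S) (f : S → ℝ)
    (hf : Measurable f) : Antitone (ν.level f hf) :=
  fun _ _ hst => ν.mono' _ _ fun _ hx => hst.trans hx

theorem NormalizedCapacity.level_eq_one (ν : NormalizedCapacity S) (f : S → ℝ)
    (hf : Measurable f) {t : ℝ} (h : ∀ s, t ≤ f s) : ν.level f hf t = 1 := by
  rw [← ν.univ', NormalizedCapacity.level]
  congr 1
  exact Subtype.ext (Set.eq_univ_of_forall h)

theorem NormalizedCapacity.level_eq_zero (ν : NormalizedCapacity S) (f : S → ℝ)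
    (hf : Measurable f) {t : ℝ} (h : ∀ s, f s < t) : ν.level f hf t = 0 := by
  rw [← ν.empty', NormalizedCapacity.level]
  congr 1
  exact Subtype.ext (Set.eq_empty_of_forall_notMem fun s hs => not_le.2 (h s) hs)

/-- For `|f| ≤ c` the Choquet integral is an integral over a bounded interval. -/
theorem NormalizedCapacity.choquet_eq_of_abs_le (ν : NormalizedCapacity S) (f : S → ℝ)
    (hf : Measurable f) {c : ℝ} (hc : 0 ≤ c) (h : ∀ s, |f s| ≤ c) :
    ν.choquet f hf = (∫ t in (-c)..c, ν.level f hf t) - c := by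
  have hint : ∀ s t, IntervalIntegrable (ν.level f hf) MeasureTheory.volume s t :=
    fun s t => (ν.level_antitone f hf).intervalIntegrable
  have h1 : ∫ t in Set.Ioi (0 : ℝ), ν.level f hf t = ∫ t in (0 : ℝ)..c, ν.level f hf t := by
    rw [intervalIntegral.integral_of_le hc]
    refine MeasureTheory.setIntegral_eq_of_subset_of_forall_sdiff_eq_zero measurableSet_Ioi
      Set.Ioc_subset_Ioi_self fun t ht => ν.level_eq_zero f hf fun s => ?_
    have : c < t := by
      by_contra! hle
      exact ht.2 ⟨ht.1, hle⟩
    exact ((le_abs_self _).trans (h s)).trans_lt this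
  have h2 : ∫ t in Set.Iic (0 : ℝ), (ν.level f hf t - ν.toFun ⟨Set.univ, MeasurableSet.univ⟩) =
      ∫ t in (-c)..0, (ν.level f hf t - 1) := by
    rw [ν.univ', intervalIntegral.integral_of_le (by linarith)]
    refine MeasureTheory.setIntegral_eq_of_subset_of_forall_sdiff_eq_zero measurableSet_Iic
      Set.Ioc_subset_Iic_self fun t ht => ?_
    have : t ≤ -c := by
      by_contra! hle
      exact ht.2 ⟨hle, ht.1⟩
    rw [ν.level_eq_one f hf fun s => this.trans (neg_le_of_abs_le (h s)), sub_self]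
  rw [NormalizedCapacity.choquet, h1, h2,
    intervalIntegral.integral_sub (hint _ _) intervalIntegrable_const,
    intervalIntegral.integral_const, ← intervalIntegral.integral_add_adjacent_intervals
      (hint (-c) 0) (hint 0 c)]
  simp only [smul_eq_mul]
  ring

end Choquet

end RieszChoquet

theorem mainTheorem2 {X : Type*} [AddCommGroup X] [Lattice X] [IsOrderedAddMonoid X]
    [Module ℝ X] [IsOrderedModule ℝ X] (hX : IsArchimedean X)
    (e : X) (he : IsUnitVector e)
    (N : Submodule ℝ X) (hN_proper : N ≠ ⊤) (hN_ideal : IsOrderIdeal N)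
    (hN_closed : IsUniformlyClosed N)
    (V : X → ℝ)
    (hV_normalized : ∀ c : ℝ, V (c • e) = c)
    (hV_monotone : ∀ x y : X, x ≤ y → V x ≤ V y)
    (hV_unitAdditive : ∀ (x : X) (c : ℝ), 0 ≤ c → V (x + c • e) = V x + V (c • e))
    (hV_unitModular : ∀ (x : X) (c : ℝ),
      V (x ⊔ c • e) + V (x ⊓ c • e) = V x + V (c • e))
    (hV_invariant : ∀ x y : X, x - y ∈ N → V x = V y) :
    ∃ ν : NormalizedCapacity (ExtremeFunctionals e N),
      ∀ x : X, (∃ C : ℝ, ∀ ξ, |evalAt e N x ξ| ≤ C) ∧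
        V x = ν.choquet (evalAt e N x) (measurable_evalAt e N x) := by
  have hV : UnitModular e N V :=
    ⟨hV_normalized, hV_monotone, hV_unitAdditive, hV_unitModular, hV_invariant⟩
  refine ⟨hV.capacity he hN_ideal, fun x => ?_⟩
  obtain ⟨c, hc, hxc⟩ := he.exists_abs_le x
  have hbound : ∀ ξ, |evalAt e N x ξ| ≤ c :=
    fun ξ => abs_le_of_abs_le_smul ξ.2.1.1.1 ξ.2.1.1.2 hxc
  refine ⟨⟨c, hbound⟩, ?_⟩
  have hx1 : x ⊓ c • e = x := inf_eq_left.2 ((le_abs_self x).trans hxc)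
  have hx2 : x ⊓ (-c) • e = (-c) • e := by
    rw [neg_smul]
    exact inf_eq_right.2 (neg_le.1 ((neg_le_abs x).trans hxc))
  rw [NormalizedCapacity.choquet_eq_of_abs_le _ _ _ hc hbound,
    integral_eq_sub_of_rectangle_bounds (NormalizedCapacity.level_antitone _ _ _)
      (F := fun t => V (x ⊓ t • e)) (fun a b hab => hV.level_mul_le he hN_ideal x hab)
      (fun a b hab => hV.le_level_mul he hN_ideal x hab) (by linarith : -c ≤ c)]
  simp only [hx1, hx2, hV_normalized]
  ring
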